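/- Let $p$ be a prime and $t\ge 1$. For $n=(1,n_1,\dots,n_t)\in\mathbb Z_p^{t+1}$ let $H_n=\{h\in\mathbb Z_p^{t+1}: h\cdot n=0\}$ and let $\mathrm{Id}_n:\mathbb Z_p^{t+1}\to\{0,1\}$ be its characteristic function. The hidden cyclic group $G_{p,t}$ of level $t$ is the quotient $\mathbb Z_p^{t+1}/H_n$ (a cyclic group of order $p$), where the unknown vector $n$ can be accessed only through queries to the identity oracle $\mathrm{Id}_n$. Elements of $G_{p,t}$ are given by representatives in $\mathbb Z_p^{t+1}$. DLOG$(G_{p,t})$: given $(g,h)$ with $g$ a generator of $G_{p,t}$, output a non-negative integer $d$ with $dg=h$ in $G_{p,t}$. CDH$(G_{p,t})$: given $(g,h,k)$ with $g$ a generator of $G_{p,t}$, output an element $\ell$ of $G_{p,t}$ such that $h=ag$, $k=bg$, $\ell=cg$ in $G_{p,t}$ for some integers $a,b,c$ with $c\equiv ab \pmod p$. The quantum (respectively randomized) query complexity of such a problem on a fixed input is the smallest number $k$ of oracle queries in a $k$-query quantum (respectively randomized) algorithm which, for every $n$ for which $g$ is a generator, outputs a correct answer with probability at least $2/3$; all operations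 other than queries are free. The query complexity of the problem is the maximum of this number over all inputs. Theorem. As $p\to\infty$ over the primes, and uniformly in $t\ge 1$: (1) the randomized query complexity of both DLOG$(G_{p,t})$ and CDH$(G_{p,t})$ is $\Omega(p)$; (2) the quantum query complexity of both DLOG$(G_{p,t})$ and CDH$(G_{p,t})$ is $\Omega(\sqrt p)$. That is, there are absolute constants $c>0$ and $N$ such that for all primes $p\ge N$ and all $t\ge 1$ these complexities are at least $c\,p$, respectively at least $c\sqrt p$. The case $t=1$ is the level-1 group $\mathbb Z_p^2$ modulo a hidden line. -/

import Mathlib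

open scoped ENNReal Matrix

noncomputable section

namespace HiddenCyclic

/-! ### The query model -/

/-- The basis states `|x⟩|a⟩|z⟩`: a query register `x`, an answer bit `a`, and a work register `z`
consisting of `r` bits. -/
abbrev BasisState (X : Type) (r : ℕ) : Type := X × Bool × (Fin r → Bool)

/-- The query operation on basis states, `|x⟩|a⟩|z⟩ ↦ |x⟩|a + f(x) mod 2⟩|z⟩`. -/
def queryBasis {X : Type} {r : ℕ} (f : X → Bool) (b : BasisState X r) : BasisState X r :=
  (b.1, xor b.2.1 (f b.1), b.2.2)

/-- The linear extension `O_f` of `queryBasis f` to states. The coefficient of `b` in the new state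
is the old coefficient of the preimage of `b`, and `queryBasis f` is its own inverse. -/
def applyQuery {X : Type} {r : ℕ} {𝕜 : Type} (f : X → Bool) (ψ : BasisState X r → 𝕜) :
    BasisState X r → 𝕜 :=
  fun b => ψ (queryBasis f b)

theorem queryBasis_queryBasis {X : Type} {r : ℕ} (f : X → Bool) (b : BasisState X r) :
    queryBasis f (queryBasis f b) = b := by
  simp [queryBasis]

theorem applyQuery_single {X : Type} [DecidableEq X] {r : ℕ} {𝕜 : Type} [Semiring 𝕜]
    (f : X → Bool) (b : BasisState X r) :
    applyQuery f (Pi.single b (1 : 𝕜)) = Pi.single (queryBasis f b) 1 := by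
  funext c
  have h : queryBasis f c = b ↔ c = queryBasis f b :=
    ⟨fun h => by rw [← h, queryBasis_queryBasis], fun h => by rw [h, queryBasis_queryBasis]⟩
  simp [applyQuery, Pi.single_apply, h]

/-- The initial state `|0⟩|0⟩|0⟩`. -/
def initialState (X : Type) [Zero X] [DecidableEq X] (r : ℕ) (𝕜 : Type) [Semiring 𝕜] :
    BasisState X r → 𝕜 :=
  Pi.single ((0 : X), false, fun _ => false) 1

/-- `run U f k` is the state after applying `U 0, O_f, U 1, O_f, …, U (k-1), O_f, U k` to the
initial state; it contains exactly `k` queries. -/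
def run {X : Type} [Fintype X] [Zero X] [DecidableEq X] {r : ℕ} {𝕜 : Type} [Semiring 𝕜]
    (U : ℕ → Matrix (BasisState X r) (BasisState X r) 𝕜) (f : X → Bool) :
    ℕ → BasisState X r → 𝕜
  | 0 => U 0 *ᵥ initialState X r 𝕜
  | k + 1 => U (k + 1) *ᵥ applyQuery f (run U f k)

/-- An oracle problem. The unknown object `i ∈ legit` is accessed through the oracle `oracle i`,
and `correct i` is the set of all correct outputs. -/
structure OracleProblem (I X R : Type) where
  legit : Set I
  oracle : I → X → Bool
  correct : I → Set R

open Classical in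
/-- There is a `k`-query quantum algorithm that, for every legitimate oracle, outputs a correct
answer with probability at least `2/3`. The output is read off from the observed content of the
work register, by a decoding map `out`. -/
def QuantumSolvable {I X R : Type} [Fintype X] [Zero X] [DecidableEq X]
    (A : OracleProblem I X R) (k : ℕ) : Prop :=
  ∃ (r : ℕ) (U : ℕ → Matrix (BasisState X r) (BasisState X r) ℂ) (out : (Fin r → Bool) → R),
    (∀ j ≤ k, U j ∈ Matrix.unitaryGroup (BasisState X r) ℂ) ∧
    ∀ i ∈ A.legit,
      (2 / 3 : ℝ) ≤ ∑ b : BasisState X r,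
        if out b.2.2 ∈ A.correct i then ‖run U (A.oracle i) k b‖ ^ 2 else 0

open Classical in
/-- There is a `k`-query randomized algorithm that, for every legitimate oracle, outputs a correct
answer with probability at least `2/3`. The operations are stochastic matrices (acting on column
vectors of probabilities, so the columns sum to one). -/
def RandomizedSolvable {I X R : Type} [Fintype X] [Zero X] [DecidableEq X]
    (A : OracleProblem I X R) (k : ℕ) : Prop :=
  ∃ (r : ℕ) (U : ℕ → Matrix (BasisState X r) (BasisState X r) ℝ) (out : (Fin r → Bool) → R),
    (∀ j ≤ k, U j ∈ Matrix.colStochastic ℝ (BasisState X r)) ∧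
    ∀ i ∈ A.legit,
      (2 / 3 : ℝ) ≤ ∑ b : BasisState X r,
        if out b.2.2 ∈ A.correct i then run U (A.oracle i) k b else 0

/-- The quantum query complexity: the least `k` for which there is a `k`-query quantum algorithm
(`⊤` if there is none). -/
def quantumQC {I X R : Type} [Fintype X] [Zero X] [DecidableEq X]
    (A : OracleProblem I X R) : ℕ∞ :=
  ⨅ (k : ℕ) (_ : QuantumSolvable A k), (k : ℕ∞)

/-- The randomized query complexity: the least `k` for which there is a `k`-query randomized
algorithm (`⊤` if there is none). -/
def randomizedQC {I X R : Type} [Fintype X] [Zero X] [DecidableEq X]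
    (A : OracleProblem I X R) : ℕ∞ :=
  ⨅ (k : ℕ) (_ : RandomizedSolvable A k), (k : ℕ∞)

/-! ### Hidden cyclic groups -/

/-- The ambient group `ℤ_p^{t+1}`. -/
abbrev Ambient (p t : ℕ) : Type := Fin (t + 1) → ZMod p

/-- The vectors of the form `(1, n₁, …, n_t)`. -/
def Suitable {p t : ℕ} (n : Ambient p t) : Prop := n 0 = 1

/-- The hidden hyperplane `H_n = {h : h · n = 0}`. -/
def hyperplane {p t : ℕ} (n : Ambient p t) : AddSubgroup (Ambient p t) where
  carrier := {h | h ⬝ᵥ n = 0}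
  zero_mem' := by simp
  add_mem' := by
    intro a b ha hb
    simp only [Set.mem_ofPred_eq] at ha hb ⊢
    rw [add_dotProduct, ha, hb, add_zero]
  neg_mem' := by
    intro a ha
    simp only [Set.mem_ofPred_eq] at ha ⊢
    rw [neg_dotProduct, ha, neg_zero]

/-- The identity oracle `Id_n`, the characteristic function of `H_n`. -/
def idOracle {p t : ℕ} (n : Ambient p t) (h : Ambient p t) : Bool := decide (h ⬝ᵥ n = 0)

/-- The hidden cyclic group of level `t`, the quotient `ℤ_p^{t+1} / H_n`. -/
abbrev HiddenGroup {p t : ℕ} (n : Ambient p t) : Type := Ambient p t ⧸ hyperplane n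

/-- The element of the hidden cyclic group encoded by `h`. -/
def toGroup {p t : ℕ} (n h : Ambient p t) : HiddenGroup n := QuotientAddGroup.mk h

/-- `g` generates the group `G`. -/
def IsGenerator {G : Type} [AddGroup G] (g : G) : Prop := AddSubgroup.zmultiples g = ⊤

/-- `(g, h, k, l)` is a Diffie–Hellman quadruple in the group `G` of order `p`. -/
def IsDHQuadruple (p : ℕ) {G : Type} [AddGroup G] (g h k l : G) : Prop :=
  IsGenerator g ∧ ∃ a b c : ℤ, h = a • g ∧ k = b • g ∧ l = c • g ∧ c ≡ a * b [ZMOD p]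

/-- The discrete logarithm problem on the fixed input `(g, h)`: the unknown is a suitable vector `n`
such that `g` is a generator, given by `Id_n`; a correct output is a non-negative integer `d` with
`d g = h` in the hidden cyclic group. -/
def dlogProblem {p t : ℕ} (g h : Ambient p t) : OracleProblem (Ambient p t) (Ambient p t) ℕ where
  legit := {n | Suitable n ∧ IsGenerator (toGroup n g)}
  oracle := idOracle
  correct n := {d | d • toGroup n g = toGroup n h}

/-- The computational Diffie–Hellman problem on the fixed input `(g, h, k)`: a correct output is an
(encoding of an) element `l` such that `(g, h, k, l)` is a Diffie–Hellman quadruple in the hidden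
cyclic group. -/
def cdhProblem {p t : ℕ} (g h k : Ambient p t) :
    OracleProblem (Ambient p t) (Ambient p t) (Ambient p t) where
  legit := {n | Suitable n ∧ IsGenerator (toGroup n g)}
  oracle := idOracle
  correct n := {l | IsDHQuadruple p (toGroup n g) (toGroup n h) (toGroup n k) (toGroup n l)}

/-- Randomized query complexity of the discrete logarithm problem in level `t`: the maximum over all
inputs. -/
def randomizedDLOG (p t : ℕ) [Fact p.Prime] : ℕ∞ :=
  ⨆ (g : Ambient p t) (h : Ambient p t), randomizedQC (dlogProblem g h)

/-- Quantum query complexity of the discrete logarithm problem in level `t`. -/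
def quantumDLOG (p t : ℕ) [Fact p.Prime] : ℕ∞ :=
  ⨆ (g : Ambient p t) (h : Ambient p t), quantumQC (dlogProblem g h)

/-- Randomized query complexity of the computational Diffie–Hellman problem in level `t`. -/
def randomizedCDH (p t : ℕ) [Fact p.Prime] : ℕ∞ :=
  ⨆ (g : Ambient p t) (h : Ambient p t) (k : Ambient p t), randomizedQC (cdhProblem g h k)

/-- Quantum query complexity of the computational Diffie–Hellman problem in level `t`. -/
def quantumCDH (p t : ℕ) [Fact p.Prime] : ℕ∞ :=
  ⨆ (g : Ambient p t) (h : Ambient p t) (k : Ambient p t), quantumQC (cdhProblem g h k)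

end HiddenCyclic

end

/-!
The map `x ↦ x · n` identifies the hidden group with `ZMod p`. Fix `g = e₀`, so that `g · n = 1` for
every suitable `n`, and let `h` (and `k`) be a second basis vector `eᵢ`. Restrict the hidden vector
to the `p` candidates `n_s = e₀ + s eᵢ`. A discrete logarithm `d` is then correct for `n_s` only if
`d = s` in `ZMod p`, and a Diffie–Hellman answer `l` only if `l₀ + lᵢ s = s²`; thus each answer is
correct for at most two candidates. On the other hand `Id_{n_s}(x)` decides whether `x₀ + xᵢ s = 0`,
and for every `x` all but at most one `s` give the same value as the baseline oracle that decides
`x₀ = xᵢ = 0`. The problem is therefore as hard as searching among `p` items.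

The search bound is the hybrid argument: compare the run with the true oracle to the run with the
baseline oracle. After `k` queries their distance is at most twice the sum over all steps of the
norm of the part of the *baseline* state that queries a position on which the two oracles differ, in
`ℓ¹` for randomized algorithms (`l1_run_sub_le`) and in `ℓ²` for quantum ones (`l2_run_sub_le`). A
single query position serves at most one candidate, so summing over all candidates bounds the total
distance by `2k`, and the total squared distance by `4k²` through the Cauchy–Schwarz inequality. The
baseline run is correct for at most two candidates per answer (`sum_sum_ite_le`). This gives `2p/3 ≤
2 + 2k` and `2p/3 ≤ 4 + 8k²` respectively.
-/

namespace HiddenCyclic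

/-! ### Query positions on which two oracles differ -/

section Hybrid

variable {X : Type} {r : ℕ}

theorem applyQuery_eq_of_eq {𝕜 : Type} {f g : X → Bool} {b : BasisState X r} (h : f b.1 = g b.1)
    (v : BasisState X r → 𝕜) : applyQuery f v b = applyQuery g v b := by
  simp [applyQuery, queryBasis, h]

variable [Fintype X]

/-- Double counting: if every `b` satisfies `P s b` for at most `m` values of `s`, then the masses
of the events `P s` add up to at most `m` times the total mass. -/
theorem sum_sum_ite_le {S B : Type} [Fintype S] [Fintype B] (P : S → B → Prop)
    [∀ s b, Decidable (P s b)] {m : ℕ} (hP : ∀ b, {s | P s b}.ncard ≤ m)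
    {w : B → ℝ} (hw : ∀ b, 0 ≤ w b) :
    ∑ s, ∑ b, (if P s b then w b else 0) ≤ m * ∑ b, w b := by
  rw [Finset.sum_comm, Finset.mul_sum]
  refine Finset.sum_le_sum fun b _ => ?_
  rw [← Finset.sum_filter, Finset.sum_const, nsmul_eq_mul]
  have h := hP b
  rw [Set.ncard_eq_toFinset_card', Set.toFinset_ofPred] at h
  exact mul_le_mul_of_nonneg_right (by exact_mod_cast h) (hw b)

/-- The part of the total weight `w` that sits on queries on which `f` and `g` differ. -/
def diffMass (f g : X → Bool) (w : BasisState X r → ℝ) : ℝ :=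
  ∑ b : BasisState X r, if f b.1 ≠ g b.1 then w b else 0

theorem sum_queryBasis (e : X → Bool) (w : BasisState X r → ℝ) :
    ∑ b, w (queryBasis e b) = ∑ b, w b :=
  Equiv.sum_comp (Function.Involutive.toPerm (queryBasis e) (queryBasis_queryBasis e)) w

theorem diffMass_queryBasis (e f g : X → Bool) (w : BasisState X r → ℝ) :
    diffMass f g (fun b => w (queryBasis e b)) = diffMass f g w :=
  sum_queryBasis e fun b => if f b.1 ≠ g b.1 then w b else 0

theorem diffMass_nonneg (f g : X → Bool) {w : BasisState X r → ℝ} (hw : ∀ b, 0 ≤ w b) :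
    0 ≤ diffMass f g w :=
  Finset.sum_nonneg fun b _ => by split_ifs <;> simp [hw b]

theorem sum_diffMass_le {S : Type} [Fintype S] (f : S → X → Bool) (g : X → Bool)
    (hf : ∀ x, {s | f s x ≠ g x}.ncard ≤ 1) {w : BasisState X r → ℝ} (hw : ∀ b, 0 ≤ w b) :
    ∑ s, diffMass (f s) g w ≤ ∑ b, w b := by
  simpa [diffMass] using sum_sum_ite_le (fun s (b : BasisState X r) => f s b.1 ≠ g b.1)
    (fun b => hf b.1) hw

/-! ### The effect of one operation on the norms of states -/

theorem sum_abs_mulVec_le {B : Type} [Fintype B] [DecidableEq B] {M : Matrix B B ℝ}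
    (hM : M ∈ Matrix.colStochastic ℝ B) (v : B → ℝ) : ∑ b, |(M *ᵥ v) b| ≤ ∑ b, |v b| := by
  rw [← Matrix.sum_mulVec_of_mem_colStochastic hM (x := fun b => |v b|)]
  refine Finset.sum_le_sum fun b _ => (Finset.abs_sum_le_sum_abs _ _).trans_eq ?_
  refine Finset.sum_congr rfl fun c _ => ?_
  rw [abs_mul, abs_of_nonneg (Matrix.nonneg_of_mem_colStochastic hM)]

theorem sum_abs_applyQuery_sub_le (f g : X → Bool) (v : BasisState X r → ℝ) :
    ∑ b, |applyQuery f v b - applyQuery g v b| ≤ 2 * diffMass f g (fun b => |v b|) := by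
  have h : ∑ b, |applyQuery f v b - applyQuery g v b| ≤
      diffMass f g (fun b => |v (queryBasis f b)|) +
        diffMass f g (fun b => |v (queryBasis g b)|) := by
    rw [diffMass, diffMass, ← Finset.sum_add_distrib]
    refine Finset.sum_le_sum fun b _ => ?_
    split_ifs with hb
    · exact abs_sub _ _
    · rw [applyQuery_eq_of_eq (not_not.1 hb)]
      simp
  rw [diffMass_queryBasis f f g fun b => |v b|, diffMass_queryBasis g f g fun b => |v b|] at h
  linarith

/-- The `ℓ²` norm of a state, needed because function spaces carry the sup norm. -/
noncomputable def l2norm {B : Type} [Fintype B] (v : B → ℂ) : ℝ := ‖WithLp.toLp 2 v‖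

theorem l2norm_nonneg {B : Type} [Fintype B] (v : B → ℂ) : 0 ≤ l2norm v := norm_nonneg _

theorem l2norm_sq {B : Type} [Fintype B] (v : B → ℂ) : l2norm v ^ 2 = ∑ b, ‖v b‖ ^ 2 := by
  simp [l2norm, EuclideanSpace.norm_sq_eq]

theorem l2norm_add_le {B : Type} [Fintype B] (v w : B → ℂ) :
    l2norm (v + w) ≤ l2norm v + l2norm w := norm_add_le _ _

theorem l2norm_mulVec {B : Type} [Fintype B] [DecidableEq B] {M : Matrix B B ℂ}
    (hM : M ∈ Matrix.unitaryGroup B ℂ) (v : B → ℂ) : l2norm (M *ᵥ v) = l2norm v := by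
  have key : ∀ u : B → ℂ, ((l2norm u ^ 2 : ℝ) : ℂ) = star u ⬝ᵥ u := by
    intro u
    rw [l2norm_sq]
    simp [dotProduct, Complex.conj_mul']
  refine (pow_left_inj₀ (l2norm_nonneg _) (l2norm_nonneg _) two_ne_zero).1 ?_
  apply Complex.ofReal_injective
  rw [key, key, Matrix.star_mulVec, Matrix.dotProduct_mulVec, Matrix.vecMul_vecMul,
    ← Matrix.star_eq_conjTranspose, Matrix.mem_unitaryGroup_iff'.1 hM, Matrix.vecMul_one]

theorem l2norm_applyQuery (f : X → Bool) (v : BasisState X r → ℂ) :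
    l2norm (applyQuery f v) = l2norm v := by
  refine (pow_left_inj₀ (l2norm_nonneg _) (l2norm_nonneg _) two_ne_zero).1 ?_
  rw [l2norm_sq, l2norm_sq]
  exact sum_queryBasis f fun b => ‖v b‖ ^ 2

theorem l2norm_applyQuery_sub_le (f g : X → Bool) (v : BasisState X r → ℂ) :
    l2norm (applyQuery f v - applyQuery g v) ≤ 2 * √(diffMass f g (fun b => ‖v b‖ ^ 2)) := by
  have h : l2norm (applyQuery f v - applyQuery g v) ^ 2 ≤
      2 * diffMass f g (fun b => ‖v (queryBasis f b)‖ ^ 2) +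
        2 * diffMass f g (fun b => ‖v (queryBasis g b)‖ ^ 2) := by
    rw [l2norm_sq, diffMass, diffMass, Finset.mul_sum, Finset.mul_sum, ← Finset.sum_add_distrib]
    refine Finset.sum_le_sum fun b _ => ?_
    split_ifs with hb
    · have h1 := norm_sub_le (v (queryBasis f b)) (v (queryBasis g b))
      have h2 := norm_nonneg (v (queryBasis f b) - v (queryBasis g b))
      simp only [Pi.sub_apply, applyQuery]
      nlinarith [sq_nonneg (‖v (queryBasis f b)‖ - ‖v (queryBasis g b)‖)]
    · rw [Pi.sub_apply, applyQuery_eq_of_eq (not_not.1 hb)]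
      simp
  rw [diffMass_queryBasis f f g fun b => ‖v b‖ ^ 2,
    diffMass_queryBasis g f g fun b => ‖v b‖ ^ 2] at h
  refine le_of_sq_le_sq ?_ (by positivity)
  rw [mul_pow, Real.sq_sqrt (diffMass_nonneg _ _ fun b => by positivity)]
  linarith

variable [Zero X] [DecidableEq X]

/-- The step of the hybrid argument: the new difference of the two runs is the old one, moved by a
norm-preserving query, plus the effect of querying the two oracles on the state of the `g`-run. -/
theorem run_succ_sub {𝕜 : Type} [Ring 𝕜]
    (U : ℕ → Matrix (BasisState X r) (BasisState X r) 𝕜) (f g : X → Bool) (k : ℕ) :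
    run U f (k + 1) - run U g (k + 1) =
      U (k + 1) *ᵥ (applyQuery f (run U f k - run U g k) +
        (applyQuery f (run U g k) - applyQuery g (run U g k))) := by
  rw [run, run, ← Matrix.mulVec_sub]
  congr 1
  funext b
  simp [applyQuery]

/-! ### The randomized hybrid argument -/

theorem sum_abs_run_le {U : ℕ → Matrix (BasisState X r) (BasisState X r) ℝ} {K : ℕ}
    (hU : ∀ j ≤ K, U j ∈ Matrix.colStochastic ℝ (BasisState X r)) (f : X → Bool) {k : ℕ}
    (hk : k ≤ K) : ∑ b, |run U f k b| ≤ 1 := by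
  induction k with
  | zero =>
    refine (sum_abs_mulVec_le (hU 0 hk) _).trans_eq ?_
    simp [initialState, Pi.single_apply, apply_ite abs]
  | succ k ih =>
    refine (sum_abs_mulVec_le (hU _ hk) _).trans ?_
    simp only [applyQuery]
    rw [sum_queryBasis f fun b => |run U f k b|]
    exact ih (by omega)

theorem l1_run_sub_le {U : ℕ → Matrix (BasisState X r) (BasisState X r) ℝ} {K : ℕ}
    (hU : ∀ j ≤ K, U j ∈ Matrix.colStochastic ℝ (BasisState X r)) (f g : X → Bool) {k : ℕ}
    (hk : k ≤ K) :
    ∑ b, |run U f k b - run U g k b| ≤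
      2 * ∑ j ∈ Finset.range k, diffMass f g (fun b => |run U g j b|) := by
  induction k with
  | zero => simp [run]
  | succ k ih =>
    have h : ∑ b, |(run U f (k + 1) - run U g (k + 1)) b| ≤
        ∑ b, |run U f k b - run U g k b| + 2 * diffMass f g (fun b => |run U g k b|) := by
      rw [run_succ_sub]
      refine (sum_abs_mulVec_le (hU _ hk) _).trans ?_
      rw [← sum_queryBasis f fun b => |run U f k b - run U g k b|]
      refine le_trans ?_ (add_le_add_right (sum_abs_applyQuery_sub_le f g (run U g k)) _)
      rw [← Finset.sum_add_distrib]
      exact Finset.sum_le_sum fun b _ => abs_add_le _ _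
    simp only [Pi.sub_apply] at h
    rw [Finset.sum_range_succ]
    linarith [ih (by omega)]

/-- The search bound for randomized algorithms: among `|S|` instances, let every query distinguish
at most one of them from the baseline oracle `g`, and let every answer be correct for at most `m` of
them. -/
theorem card_le_of_randomizedSolvable {I R S : Type} [Fintype S] {A : OracleProblem I X R} {K : ℕ}
    (hA : RandomizedSolvable A K) (n : S → I) (hn : ∀ s, n s ∈ A.legit) (g : X → Bool)
    (hg : ∀ x, {s | A.oracle (n s) x ≠ g x}.ncard ≤ 1) {m : ℕ}
    (hm : ∀ o, {s | o ∈ A.correct (n s)}.ncard ≤ m) :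
    2 / 3 * (Fintype.card S : ℝ) ≤ m + 2 * K := by
  classical
  obtain ⟨r, U, out, hU, hsucc⟩ := hA
  have hs : ∀ s, (2 / 3 : ℝ) ≤
      (∑ b : BasisState X r, if out b.2.2 ∈ A.correct (n s) then |run U g K b| else 0) +
        2 * ∑ j ∈ Finset.range K, diffMass (A.oracle (n s)) g (fun b => |run U g j b|) := by
    intro s
    refine le_trans ?_ (add_le_add_right (l1_run_sub_le hU (A.oracle (n s)) g le_rfl) _)
    refine (hsucc (n s) (hn s)).trans ?_
    rw [← Finset.sum_add_distrib]
    refine Finset.sum_le_sum fun b _ => ?_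
    have h1 := le_abs_self (run U g K b)
    have h2 := le_abs_self (run U (A.oracle (n s)) K b - run U g K b)
    split_ifs
    · linarith
    · simp
  have hsum := Finset.sum_le_sum fun s (_ : s ∈ Finset.univ) => hs s
  rw [Finset.sum_const, Finset.sum_add_distrib, ← Finset.mul_sum, Finset.sum_comm (s := Finset.univ)
      (t := Finset.range K),
    nsmul_eq_mul, Finset.card_univ] at hsum
  have h1 := sum_sum_ite_le (fun s (b : BasisState X r) => out b.2.2 ∈ A.correct (n s))
    (fun b => hm (out b.2.2)) (w := fun b => |run U g K b|) (fun b => abs_nonneg _)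
  have h2 : ∑ j ∈ Finset.range K, ∑ s, diffMass (A.oracle (n s)) g (fun b => |run U g j b|) ≤ K := by
    refine (Finset.sum_le_card_nsmul _ _ 1 fun j hj => ?_).trans (by simp)
    exact (sum_diffMass_le _ g hg fun b => abs_nonneg _).trans
      (sum_abs_run_le hU g (Finset.mem_range.1 hj).le)
  have h3 : (m : ℝ) * ∑ b, |run U g K b| ≤ m :=
    mul_le_of_le_one_right (Nat.cast_nonneg m) (sum_abs_run_le hU g le_rfl)
  linarith

/-! ### The quantum hybrid argument -/

theorem l2norm_run {U : ℕ → Matrix (BasisState X r) (BasisState X r) ℂ} {K : ℕ}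
    (hU : ∀ j ≤ K, U j ∈ Matrix.unitaryGroup (BasisState X r) ℂ) (f : X → Bool) {k : ℕ}
    (hk : k ≤ K) : l2norm (run U f k) = 1 := by
  induction k with
  | zero =>
    rw [run, l2norm_mulVec (hU 0 hk), ← pow_left_inj₀ (l2norm_nonneg _) zero_le_one two_ne_zero,
      l2norm_sq]
    simp [initialState, Pi.single_apply, apply_ite norm]
  | succ k ih =>
    rw [run, l2norm_mulVec (hU _ hk), l2norm_applyQuery, ih (by omega)]

theorem l2_run_sub_le {U : ℕ → Matrix (BasisState X r) (BasisState X r) ℂ} {K : ℕ}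
    (hU : ∀ j ≤ K, U j ∈ Matrix.unitaryGroup (BasisState X r) ℂ) (f g : X → Bool) {k : ℕ}
    (hk : k ≤ K) :
    l2norm (run U f k - run U g k) ≤
      2 * ∑ j ∈ Finset.range k, √(diffMass f g (fun b => ‖run U g j b‖ ^ 2)) := by
  induction k with
  | zero => simp [run, l2norm]
  | succ k ih =>
    rw [run_succ_sub, l2norm_mulVec (hU _ hk), Finset.sum_range_succ, mul_add]
    refine (l2norm_add_le _ _).trans (add_le_add ?_ (l2norm_applyQuery_sub_le f g _))
    rw [l2norm_applyQuery]
    exact ih (by omega)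

theorem l2_run_sub_sq_le {U : ℕ → Matrix (BasisState X r) (BasisState X r) ℂ} {K : ℕ}
    (hU : ∀ j ≤ K, U j ∈ Matrix.unitaryGroup (BasisState X r) ℂ) (f g : X → Bool) :
    l2norm (run U f K - run U g K) ^ 2 ≤
      4 * (K * ∑ j ∈ Finset.range K, diffMass f g (fun b => ‖run U g j b‖ ^ 2)) := by
  have h := pow_le_pow_left₀ (l2norm_nonneg _) (l2_run_sub_le hU f g le_rfl) 2
  refine h.trans ?_
  have hcs := sq_sum_le_card_mul_sum_sq (s := Finset.range K)
    (f := fun j => √(diffMass f g (fun b => ‖run U g j b‖ ^ 2)))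
  rw [Finset.card_range, Finset.sum_congr rfl fun j _ =>
    Real.sq_sqrt (diffMass_nonneg f g fun b => sq_nonneg ‖run U g j b‖)] at hcs
  rw [mul_pow]
  linarith

/-- The search bound for quantum algorithms, under the same hypotheses as
`card_le_of_randomizedSolvable`. -/
theorem card_le_of_quantumSolvable {I R S : Type} [Fintype S] {A : OracleProblem I X R} {K : ℕ}
    (hA : QuantumSolvable A K) (n : S → I) (hn : ∀ s, n s ∈ A.legit) (g : X → Bool)
    (hg : ∀ x, {s | A.oracle (n s) x ≠ g x}.ncard ≤ 1) {m : ℕ}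
    (hm : ∀ o, {s | o ∈ A.correct (n s)}.ncard ≤ m) :
    2 / 3 * (Fintype.card S : ℝ) ≤ 2 * m + 8 * (K : ℝ) ^ 2 := by
  classical
  obtain ⟨r, U, out, hU, hsucc⟩ := hA
  have hs : ∀ s, (2 / 3 : ℝ) ≤
      2 * (∑ b : BasisState X r,
        if out b.2.2 ∈ A.correct (n s) then ‖run U g K b‖ ^ 2 else 0) +
        8 * (K * ∑ j ∈ Finset.range K,
          diffMass (A.oracle (n s)) g (fun b => ‖run U g j b‖ ^ 2)) := by
    intro s
    have hd := l2_run_sub_sq_le hU (A.oracle (n s)) g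
    rw [l2norm_sq] at hd
    have h : (2 / 3 : ℝ) ≤ ∑ b : BasisState X r,
        (2 * (if out b.2.2 ∈ A.correct (n s) then ‖run U g K b‖ ^ 2 else 0) +
          2 * ‖(run U (A.oracle (n s)) K - run U g K) b‖ ^ 2) := by
      refine (hsucc (n s) (hn s)).trans (Finset.sum_le_sum fun b _ => ?_)
      split_ifs
      · have h1 := norm_add_le (run U g K b) (run U (A.oracle (n s)) K b - run U g K b)
        rw [add_sub_cancel] at h1
        have h2 := norm_nonneg (run U (A.oracle (n s)) K b)
        rw [Pi.sub_apply]
        nlinarith [sq_nonneg (‖run U g K b‖ - ‖run U (A.oracle (n s)) K b - run U g K b‖)]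
      · positivity
    rw [Finset.sum_add_distrib, ← Finset.mul_sum, ← Finset.mul_sum] at h
    linarith
  have hsum := Finset.sum_le_sum fun s (_ : s ∈ Finset.univ) => hs s
  rw [Finset.sum_const, Finset.sum_add_distrib, ← Finset.mul_sum, ← Finset.mul_sum,
    ← Finset.mul_sum, Finset.sum_comm (s := Finset.univ) (t := Finset.range K),
    nsmul_eq_mul, Finset.card_univ] at hsum
  have hrun : ∀ j ≤ K, ∑ b, ‖run U g j b‖ ^ 2 = 1 := fun j hj => by
    rw [← l2norm_sq, l2norm_run hU g hj, one_pow]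
  have h1 := sum_sum_ite_le (fun s (b : BasisState X r) => out b.2.2 ∈ A.correct (n s))
    (fun b => hm (out b.2.2)) (w := fun b => ‖run U g K b‖ ^ 2) (fun b => sq_nonneg _)
  rw [hrun K le_rfl, mul_one] at h1
  have h2 : ∑ j ∈ Finset.range K, ∑ s,
      diffMass (A.oracle (n s)) g (fun b => ‖run U g j b‖ ^ 2) ≤ K := by
    refine (Finset.sum_le_card_nsmul _ _ 1 fun j hj => ?_).trans (by simp)
    exact (sum_diffMass_le _ g hg fun b => sq_nonneg _).trans
      (hrun j (Finset.mem_range.1 hj).le).le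
  have h3 := mul_le_mul_of_nonneg_left h2 (Nat.cast_nonneg (α := ℝ) K)
  linarith

theorem le_randomizedQC {I R : Type} {A : OracleProblem I X R} {x : ℝ}
    (h : ∀ k : ℕ, RandomizedSolvable A k → x ≤ k) :
    ENNReal.ofReal x ≤ (randomizedQC A : ℝ≥0∞) := by
  have h1 : ((⌈x⌉₊ : ℕ) : ℕ∞) ≤ randomizedQC A :=
    le_iInf₂ fun k hk => by exact_mod_cast Nat.ceil_le.2 (h k hk)
  refine le_trans ?_ (ENat.toENNReal_le.2 h1)
  rw [ENat.toENNReal_coe, ← ENNReal.ofReal_natCast]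
  exact ENNReal.ofReal_le_ofReal (Nat.le_ceil x)

theorem le_quantumQC {I R : Type} {A : OracleProblem I X R} {x : ℝ}
    (h : ∀ k : ℕ, QuantumSolvable A k → x ≤ k) :
    ENNReal.ofReal x ≤ (quantumQC A : ℝ≥0∞) := by
  have h1 : ((⌈x⌉₊ : ℕ) : ℕ∞) ≤ quantumQC A :=
    le_iInf₂ fun k hk => by exact_mod_cast Nat.ceil_le.2 (h k hk)
  refine le_trans ?_ (ENat.toENNReal_le.2 h1)
  rw [ENat.toENNReal_coe, ← ENNReal.ofReal_natCast]
  exact ENNReal.ofReal_le_ofReal (Nat.le_ceil x)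

end Hybrid

/-! ### The search family inside the hidden cyclic groups -/

section Family

variable {p t : ℕ}

theorem toGroup_eq_iff {n a b : Ambient p t} : toGroup n a = toGroup n b ↔ a ⬝ᵥ n = b ⬝ᵥ n := by
  rw [toGroup, toGroup, QuotientAddGroup.eq]
  change (-a + b) ⬝ᵥ n = 0 ↔ _
  rw [add_dotProduct, neg_dotProduct, neg_add_eq_zero]

theorem nsmul_toGroup_eq_iff {d : ℕ} {n a b : Ambient p t} :
    d • toGroup n a = toGroup n b ↔ (d : ZMod p) * (a ⬝ᵥ n) = b ⬝ᵥ n := by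
  change toGroup n (d • a) = _ ↔ _
  rw [toGroup_eq_iff, smul_dotProduct, nsmul_eq_mul]

theorem eq_zsmul_toGroup_iff {d : ℤ} {n a b : Ambient p t} :
    toGroup n b = d • toGroup n a ↔ b ⬝ᵥ n = (d : ZMod p) * (a ⬝ᵥ n) := by
  change _ = toGroup n (d • a) ↔ _
  rw [toGroup_eq_iff, smul_dotProduct, zsmul_eq_mul]

/-- The candidate hidden vector `e₀ + s eᵢ`, for `i` the last index. -/
def candidate (p t : ℕ) (s : ZMod p) : Ambient p t := Pi.single 0 1 + Pi.single (Fin.last t) s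

theorem dotProduct_candidate (x : Ambient p t) (s : ZMod p) :
    x ⬝ᵥ candidate p t s = x 0 + x (Fin.last t) * s := by
  simp [candidate, dotProduct_add]

theorem zero_ne_last (ht : 1 ≤ t) : (0 : Fin (t + 1)) ≠ Fin.last t := by
  rw [Ne, Fin.ext_iff]
  simp
  omega

theorem single_zero_dotProduct_candidate (ht : 1 ≤ t) (s : ZMod p) :
    (Pi.single 0 1 : Ambient p t) ⬝ᵥ candidate p t s = 1 := by
  rw [dotProduct_candidate]
  simp [(zero_ne_last ht).symm]

theorem single_last_dotProduct_candidate (ht : 1 ≤ t) (s : ZMod p) :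
    (Pi.single (Fin.last t) 1 : Ambient p t) ⬝ᵥ candidate p t s = s := by
  rw [dotProduct_candidate]
  simp [zero_ne_last ht]

variable [Fact p.Prime]

theorem candidate_legit (ht : 1 ≤ t) (s : ZMod p) :
    Suitable (candidate p t s) ∧ IsGenerator (toGroup (candidate p t s) (Pi.single 0 1)) := by
  refine ⟨by simp [Suitable, candidate, zero_ne_last ht], ?_⟩
  rw [IsGenerator, eq_top_iff]
  intro x _
  induction x using QuotientAddGroup.induction_on with
  | H x =>
    refine AddSubgroup.mem_zmultiples_iff.2 ⟨((x ⬝ᵥ candidate p t s).val : ℤ), Eq.symm ?_⟩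
    refine eq_zsmul_toGroup_iff.2 ?_
    simp [single_zero_dotProduct_candidate ht]

/-- The identity oracle without the knowledge of `s`: the value that `Id_{e₀ + s eᵢ}` takes for all
`s` with at most one exception. -/
def baseline (p t : ℕ) (x : Ambient p t) : Bool := decide (x 0 = 0 ∧ x (Fin.last t) = 0)

theorem ncard_idOracle_ne_baseline_le (x : Ambient p t) :
    {s | idOracle (candidate p t s) x ≠ baseline p t x}.ncard ≤ 1 := by
  refine (Set.ncard_le_one (Set.toFinite _)).2 fun s hs s' hs' => ?_
  simp only [idOracle, baseline, dotProduct_candidate, Set.mem_ofPred_eq, ne_eq,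
    decide_eq_decide] at hs hs'
  by_cases h1 : x (Fin.last t) = 0
  · simp [h1] at hs
  · simp only [h1, and_false, iff_false, not_not] at hs hs'
    exact mul_left_cancel₀ h1 (add_left_cancel (hs.trans hs'.symm))

theorem ncard_dlog_correct_le (ht : 1 ≤ t) (d : ℕ) :
    {s : ZMod p | d ∈ (dlogProblem (Pi.single 0 1 : Ambient p t)
      (Pi.single (Fin.last t) 1)).correct (candidate p t s)}.ncard ≤ 2 := by
  refine le_trans ((Set.ncard_le_one (Set.toFinite _)).2 fun s hs s' hs' => ?_) one_le_two
  have key : ∀ s : ZMod p, d ∈ (dlogProblem (Pi.single 0 1 : Ambient p t)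
      (Pi.single (Fin.last t) 1)).correct (candidate p t s) → (d : ZMod p) = s := by
    intro s h
    have h := nsmul_toGroup_eq_iff.1 h
    rwa [single_zero_dotProduct_candidate ht, single_last_dotProduct_candidate ht, mul_one] at h
  rw [← key s hs, key s' hs']

theorem sq_eq_of_cdh_correct (ht : 1 ≤ t) {l : Ambient p t} {s : ZMod p}
    (h : l ∈ (cdhProblem (Pi.single 0 1 : Ambient p t) (Pi.single (Fin.last t) 1)
      (Pi.single (Fin.last t) 1)).correct (candidate p t s)) :
    l 0 + l (Fin.last t) * s = s ^ 2 := by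
  obtain ⟨-, a, b, c, ha, hb, hc, habc⟩ := h
  rw [eq_zsmul_toGroup_iff, single_zero_dotProduct_candidate ht, mul_one] at ha hb hc
  rw [single_last_dotProduct_candidate ht] at ha hb
  have h := (ZMod.intCast_eq_intCast_iff c (a * b) p).2 habc
  rw [← dotProduct_candidate, hc, h, Int.cast_mul, ← ha, ← hb, sq]

theorem ncard_cdh_correct_le (ht : 1 ≤ t) (l : Ambient p t) :
    {s : ZMod p | l ∈ (cdhProblem (Pi.single 0 1 : Ambient p t) (Pi.single (Fin.last t) 1)
      (Pi.single (Fin.last t) 1)).correct (candidate p t s)}.ncard ≤ 2 := by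
  rcases Set.eq_empty_or_nonempty {s : ZMod p | l ∈ (cdhProblem (Pi.single 0 1 : Ambient p t)
    (Pi.single (Fin.last t) 1) (Pi.single (Fin.last t) 1)).correct (candidate p t s)} with h | ⟨s, hs⟩
  · simp [h]
  · have hs := sq_eq_of_cdh_correct ht hs
    -- the two roots of `X² - l i * X - l 0` add up to `l i`
    refine (Set.ncard_le_ncard (t := {s, l (Fin.last t) - s}) fun s' hs' => ?_).trans
      ((Set.ncard_insert_le _ _).trans (by simp))
    have hs' := sq_eq_of_cdh_correct ht hs'
    have h : (s' - s) * (s' - (l (Fin.last t) - s)) = 0 := by linear_combination hs - hs'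
    rcases mul_eq_zero.1 h with h | h
    · exact Or.inl (sub_eq_zero.1 h)
    · exact Or.inr (sub_eq_zero.1 h)

/-- For `p ≥ 12` the additive term, which accounts for answers that are correct by chance, costs at
most a constant factor: `2p/3 ≤ 2 + 2k` becomes `k ≥ p/6`. -/
theorem div_six_le {k : ℕ} (hp : 12 ≤ p)
    (h : 2 / 3 * (Fintype.card (ZMod p) : ℝ) ≤ (2 : ℕ) + 2 * k) : 1 / 6 * (p : ℝ) ≤ k := by
  rw [ZMod.card] at h
  have : (12 : ℝ) ≤ p := by exact_mod_cast hp
  push_cast at h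
  linarith

/-- From `2p/3 ≤ 4 + 8k²` and `p ≥ 12` follows `k² ≥ p/24`, which is at least `(√p/5)²`. -/
theorem sqrt_div_five_le {k : ℕ} (hp : 12 ≤ p)
    (h : 2 / 3 * (Fintype.card (ZMod p) : ℝ) ≤ 2 * (2 : ℕ) + 8 * (k : ℝ) ^ 2) :
    1 / 5 * √(p : ℝ) ≤ k := by
  rw [ZMod.card] at h
  have : (12 : ℝ) ≤ p := by exact_mod_cast hp
  push_cast at h
  refine le_of_sq_le_sq ?_ (Nat.cast_nonneg k)
  rw [mul_pow, Real.sq_sqrt (Nat.cast_nonneg p)]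
  linarith

end Family

end HiddenCyclic

theorem theorem1 :
    (∃ c : ℝ, 0 < c ∧ ∃ N : ℕ, ∀ (p : ℕ) [Fact p.Prime], N ≤ p → ∀ t : ℕ, 1 ≤ t →
      ENNReal.ofReal (c * p) ≤ (HiddenCyclic.randomizedDLOG p t : ℝ≥0∞) ∧
      ENNReal.ofReal (c * p) ≤ (HiddenCyclic.randomizedCDH p t : ℝ≥0∞)) ∧
    (∃ c : ℝ, 0 < c ∧ ∃ N : ℕ, ∀ (p : ℕ) [Fact p.Prime], N ≤ p → ∀ t : ℕ, 1 ≤ t →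
      ENNReal.ofReal (c * Real.sqrt p) ≤ (HiddenCyclic.quantumDLOG p t : ℝ≥0∞) ∧
      ENNReal.ofReal (c * Real.sqrt p) ≤ (HiddenCyclic.quantumCDH p t : ℝ≥0∞)) := by
  open HiddenCyclic in
  refine ⟨⟨1 / 6, by norm_num, 12, fun p _ hp t ht => ⟨?_, ?_⟩⟩,
    ⟨1 / 5, by norm_num, 12, fun p _ hp t ht => ⟨?_, ?_⟩⟩⟩
  · refine (le_randomizedQC fun k hk => ?_).trans (ENat.toENNReal_le.2
      (le_iSup₂_of_le (Pi.single 0 1) (Pi.single (Fin.last t) 1) le_rfl))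
    exact div_six_le hp (card_le_of_randomizedSolvable hk (candidate p t) (candidate_legit ht)
      (baseline p t) ncard_idOracle_ne_baseline_le (ncard_dlog_correct_le ht))
  · refine (le_randomizedQC fun k hk => ?_).trans (ENat.toENNReal_le.2
      (le_iSup₂_of_le (Pi.single 0 1) (Pi.single (Fin.last t) 1)
        (le_iSup_of_le (Pi.single (Fin.last t) 1) le_rfl)))
    exact div_six_le hp (card_le_of_randomizedSolvable hk (candidate p t) (candidate_legit ht)
      (baseline p t) ncard_idOracle_ne_baseline_le (ncard_cdh_correct_le ht))
  · refine (le_quantumQC fun k hk => ?_).trans (ENat.toENNReal_le.2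
      (le_iSup₂_of_le (Pi.single 0 1) (Pi.single (Fin.last t) 1) le_rfl))
    exact sqrt_div_five_le hp (card_le_of_quantumSolvable hk (candidate p t) (candidate_legit ht)
      (baseline p t) ncard_idOracle_ne_baseline_le (ncard_dlog_correct_le ht))
  · refine (le_quantumQC fun k hk => ?_).trans (ENat.toENNReal_le.2
      (le_iSup₂_of_le (Pi.single 0 1) (Pi.single (Fin.last t) 1)
        (le_iSup_of_le (Pi.single (Fin.last t) 1) le_rfl)))
    exact sqrt_div_five_le hp (card_le_of_quantumSolvable hk (candidate p t) (candidate_legit ht)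
      (baseline p t) ncard_idOracle_ne_baseline_le (ncard_cdh_correct_le ht))
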